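/- Let $\mathbb T=\mathbb R/\mathbb Z$ with Lebesgue (Haar) probability measure $\mu$, and let $T:\mathbb T\to\mathbb T$, $Tx=x+\alpha$, be an ergodic rotation. Let $f:\mathbb T\to\mathbb R$ satisfy $f(x)\ge c$ for all $x$, for some constant $c>0$, and suppose that $f$ is piecewise absolutely continuous: there are finitely many points $\beta_1,\dots,\beta_k\in\mathbb T$ (in cyclic order, $\beta_{k+1}=\beta_1$) such that $f$ is absolutely continuous on each open arc $(\beta_j,\beta_{j+1})$. Assume that the sum of jumps $$S(f)=\sum_{j=1}^k\bigl(f_-(\beta_j)-f_+(\beta_j)\bigr),\qquad f_\pm(\beta)=\lim_{y\to\beta^\pm}f(y),$$ is non-zero. For $m\in\mathbb Z$ put $f^{(m)}(x)=\sum_{i=0}^{m-1}f(T^ix)$ if $m>0$, $f^{(0)}=0$, and $f^{(m)}(x)=-\sum_{i=m}^{-1}f(T^ix)$ if $m<0$. Let $T^f=(T^f_t)_{t\in\mathbb R}$ be the special flow on $X^f=\{(x,s)\in\mathbb T\times\mathbb R: 0\le s<f(x)\}$, equipped with the restriction $\mu^f$ of $\mu\otimes\text{Lebesgue}$, given by $T^f_t(x,s)=(T^nx,\,s+t-f^{(n)}(x))$,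 where $n\in\mathbb Z$ is the unique integer with $f^{(n)}(x)\le s+t<f^{(n+1)}(x)$. Then $T^f$ is not partially rigid along any real sequence $(t_n)$ with $t_n\to+\infty$; that is, for no such sequence does there exist $0<u\le1$ such that $$\liminf_{n\to\infty}\mu^f\bigl(A\cap T^f_{-t_n}A\bigr)\ge u\,\mu^f(A)\quad\text{for every measurable }A\subseteq X^f.$$ -/

import Mathlib

open Set Filter Topology MeasureTheory

noncomputable section

namespace SpecialFlow

/-! ### Cocycles and special flows -/

section Flow

/-- The cocycle `f^(m)(x)` over an invertible map `T`:
`f x + f (T x) + ⋯ + f (T^(m-1) x)` for `m > 0`, `0` for `m = 0`, and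
`-(f (T^m x) + ⋯ + f (T^(-1) x))` for `m < 0`. -/
def cocycle {X : Type*} (T : Equiv.Perm X) (f : X → ℝ) : ℤ → X → ℝ
  | Int.ofNat n, x => ∑ i ∈ Finset.range n, f ((T ^ (i : ℤ)) x)
  | Int.negSucc n, x => -∑ i ∈ Finset.range (n + 1), f ((T ^ (-((i : ℤ) + 1))) x)

/-- `f` is positive and bounded away from zero. -/
def BoundedAwayFromZero {X : Type*} (f : X → ℝ) : Prop :=
  ∃ c : ℝ, 0 < c ∧ ∀ x, c ≤ f x

theorem cocycle_zero {X : Type*} (T : Equiv.Perm X) (f : X → ℝ) (x : X) :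
    cocycle T f 0 x = 0 := by
  change ∑ i ∈ Finset.range 0, f ((T ^ (i : ℤ)) x) = 0
  simp

theorem cocycle_succ {X : Type*} (T : Equiv.Perm X) (f : X → ℝ) (m : ℤ) (x : X) :
    cocycle T f (m + 1) x = cocycle T f m x + f ((T ^ m) x) := by
  rcases m with n | n
  · change ∑ i ∈ Finset.range (n + 1), f ((T ^ (i : ℤ)) x) = _
    rw [Finset.sum_range_succ]
    rfl
  · have h : (Int.negSucc n : ℤ) = -((n : ℤ) + 1) := Int.negSucc_eq n
    have h2 : cocycle T f (Int.negSucc n) x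
        = -∑ i ∈ Finset.range (n + 1), f ((T ^ (-((i : ℤ) + 1))) x) := rfl
    rw [h2, Finset.sum_range_succ, h]
    rcases n with _ | n
    · simp [cocycle_zero]
    · have h3 : -(((n + 1 : ℕ) : ℤ) + 1) + 1 = Int.negSucc n := by
        rw [Int.negSucc_eq]; push_cast; ring
      rw [h3]
      change -∑ i ∈ Finset.range (n + 1), f ((T ^ (-((i : ℤ) + 1))) x) = _
      ring

theorem cocycle_add_le {X : Type*} (T : Equiv.Perm X) {f : X → ℝ} {c : ℝ}
    (hf : ∀ x, c ≤ f x) (x : X) (m : ℤ) (k : ℕ) :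
    cocycle T f m x + k * c ≤ cocycle T f (m + k) x := by
  induction k with
  | zero => simp
  | succ k ih =>
    have h := cocycle_succ T f (m + k) x
    have h' := hf ((T ^ (m + (k : ℤ))) x)
    have e : m + ((k + 1 : ℕ) : ℤ) = m + k + 1 := by push_cast; ring
    rw [e, h]
    push_cast
    linarith

/-- For a roof bounded away from zero, every real number `r` lies in exactly one of the intervals
`[f^(n)(x), f^(n+1)(x))`. -/
theorem existsUnique_index {X : Type*} (T : Equiv.Perm X) {f : X → ℝ}
    (hf : BoundedAwayFromZero f) (x : X) (r : ℝ) :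
    ∃! n : ℤ, cocycle T f n x ≤ r ∧ r < cocycle T f (n + 1) x := by
  obtain ⟨c, hc, hf⟩ := hf
  have mono : ∀ m n : ℤ, m ≤ n → cocycle T f m x + (n - m) * c ≤ cocycle T f n x := by
    intro m n hmn
    obtain ⟨k, rfl⟩ := Int.le.dest hmn
    have := cocycle_add_le T hf x m k
    push_cast
    simpa using this
  obtain ⟨N, hN⟩ := exists_nat_gt (|r| / c)
  have hN' : |r| < N * c := by rwa [div_lt_iff₀ hc] at hN
  have hr := abs_lt.1 hN'
  have hlow : cocycle T f (-(N : ℤ)) x ≤ r := by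
    have h := mono (-(N : ℤ)) 0 (by omega)
    rw [cocycle_zero] at h
    push_cast at h
    linarith
  have hbd : ∀ n : ℤ, cocycle T f n x ≤ r → n ≤ N := by
    intro n hn
    by_contra hlt
    have h := mono 0 n (by omega)
    rw [cocycle_zero] at h
    have hnN : (N : ℝ) < n := by exact_mod_cast not_le.1 hlt
    have := mul_lt_mul_of_pos_right hnN hc
    push_cast at h
    linarith
  obtain ⟨n, hn, hmax⟩ := Int.exists_greatest_of_bdd ⟨(N : ℤ), hbd⟩ ⟨_, hlow⟩
  refine ⟨n, ⟨hn, ?_⟩, ?_⟩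
  · by_contra h
    have := hmax (n + 1) (not_lt.1 h)
    omega
  · rintro m ⟨hm1, hm2⟩
    have h1 := hmax m hm1
    by_contra hne
    have h := mono (m + 1) n (by omega)
    have h0 : ((m : ℝ) + 1) ≤ n := by exact_mod_cast (show m + 1 ≤ n by omega)
    have h2 : 0 ≤ ((n : ℝ) - (m + 1)) * c := mul_nonneg (by linarith) hc.le
    push_cast at h
    linarith

/-- The unique `n` with `f^(n)(x) ≤ r < f^(n+1)(x)`. -/
def index {X : Type*} (T : Equiv.Perm X) {f : X → ℝ}
    (hf : BoundedAwayFromZero f) (x : X) (r : ℝ) : ℤ :=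
  (existsUnique_index T hf x r).choose

theorem index_spec {X : Type*} (T : Equiv.Perm X) {f : X → ℝ}
    (hf : BoundedAwayFromZero f) (x : X) (r : ℝ) :
    cocycle T f (index T hf x r) x ≤ r ∧ r < cocycle T f (index T hf x r + 1) x :=
  (existsUnique_index T hf x r).choose_spec.1

/-- The phase space `X^f = {(x, s) : 0 ≤ s < f x}` of the special flow under `f`. -/
def Space {X : Type*} (f : X → ℝ) : Type _ := {p : X × ℝ // 0 ≤ p.2 ∧ p.2 < f p.1}

instance {X : Type*} [MeasurableSpace X] (f : X → ℝ) : MeasurableSpace (Space f) :=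
  inferInstanceAs (MeasurableSpace {p : X × ℝ // 0 ≤ p.2 ∧ p.2 < f p.1})

/-- The measure `μ^f`: the restriction of `μ ⊗ Lebesgue` to `X^f`. -/
def measure {X : Type*} [MeasurableSpace X] (μ : Measure X) (f : X → ℝ) : Measure (Space f) :=
  (μ.prod (volume : Measure ℝ)).comap Subtype.val

/-- The special flow `T^f` : `T^f_t (x, s) = (T^n x, s + t - f^(n)(x))` where
`f^(n)(x) ≤ s + t < f^(n+1)(x)`. -/
def flow {X : Type*} (T : Equiv.Perm X) {f : X → ℝ} (hf : BoundedAwayFromZero f)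
    (t : ℝ) (p : Space f) : Space f :=
  ⟨((T ^ index T hf p.1.1 (p.1.2 + t)) p.1.1,
      p.1.2 + t - cocycle T f (index T hf p.1.1 (p.1.2 + t)) p.1.1), by
    obtain ⟨h1, h2⟩ := index_spec T hf p.1.1 (p.1.2 + t)
    rw [cocycle_succ] at h2
    exact ⟨sub_nonneg.2 h1, by dsimp only; linarith⟩⟩

/-- A flow `S` on `(Y, μ)` is partially rigid along `(t_n)` if for some `0 < u ≤ 1`,
`liminf μ (A ∩ S_{-t_n} A) ≥ u μ(A)` for every measurable `A`. Here `S_{-t} A` is written as the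
preimage of `A` under `S_t`. -/
def PartiallyRigidAlong {Y : Type*} [MeasurableSpace Y] (S : ℝ → Y → Y) (μ : Measure Y)
    (t : ℕ → ℝ) : Prop :=
  ∃ u : ℝ, 0 < u ∧ u ≤ 1 ∧ ∀ A : Set Y, MeasurableSet A →
    ENNReal.ofReal u * μ A ≤ liminf (fun n => μ (A ∩ S (t n) ⁻¹' A)) atTop

end Flow

/-! ### Piecewise absolutely continuous functions on the circle -/

section Circle

/-- `g` is absolutely continuous on the open interval `(a, b)`. -/
def AbsContOnIoo (g : ℝ → ℝ) (a b : ℝ) : Prop :=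
  ∀ ε > 0, ∃ δ > 0, ∀ (n : ℕ) (u v : Fin n → ℝ),
    (∀ i, u i ∈ Ioo a b ∧ v i ∈ Ioo a b ∧ u i ≤ v i) →
    Pairwise (fun i j => Disjoint (Ioo (u i) (v i)) (Ioo (u j) (v j))) →
    ∑ i, (v i - u i) < δ → ∑ i, |g (v i) - g (u i)| < ε

/-- `f` is piecewise absolutely continuous on the circle `ℝ / ℤ` with break points in the finite
set `B`: it is absolutely continuous on every open arc that contains no point of `B` (arcs are
parametrized by open intervals of the real line). When `B` is nonempty this says that `f` is
absolutely continuous on each open arc between cyclically consecutive points of `B`. -/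
def PiecewiseAbsCont (f : UnitAddCircle → ℝ) (B : Finset UnitAddCircle) : Prop :=
  ∀ a b : ℝ, a < b → (∀ x ∈ Ioo a b, (x : UnitAddCircle) ∉ B) →
    AbsContOnIoo (fun x : ℝ => f (x : UnitAddCircle)) a b

/-- The left limit `f_-(β)`. It exists for piecewise absolutely continuous `f`. -/
def leftLimit (f : UnitAddCircle → ℝ) (β : UnitAddCircle) : ℝ :=
  limUnder (𝓝[<] (0 : ℝ)) (fun h : ℝ => f (β + (h : UnitAddCircle)))

/-- The right limit `f_+(β)`. It exists for piecewise absolutely continuous `f`. -/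
def rightLimit (f : UnitAddCircle → ℝ) (β : UnitAddCircle) : ℝ :=
  limUnder (𝓝[>] (0 : ℝ)) (fun h : ℝ => f (β + (h : UnitAddCircle)))

/-- The sum of jumps `S(f) = ∑ (f_-(β) - f_+(β))` over the break points. -/
def sumOfJumps (f : UnitAddCircle → ℝ) (B : Finset UnitAddCircle) : ℝ :=
  ∑ β ∈ B, (leftLimit f β - rightLimit f β)

/-- The rotation `x ↦ x + α` of the circle. -/
def rotation (α : UnitAddCircle) : Equiv.Perm UnitAddCircle := Equiv.addRight α

end Circle

end SpecialFlow

end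

namespace SpecialFlow

/-! Test partial rigidity on the strip {s < ε} with ε < c. A point over x that starts in the strip
and is back in it at time t forces |f^(j)(x) - t| < ε for some j ≥ 0. Dividing out the height ε,
partial rigidity with constant u gives a set of such x of measure at least about u, however small ε
is (`PartiallyRigidAlong.exists_le_liminf`). This contradicts `exists_eventually_volume_close_le`: a
suitable ε makes the set smaller than u/2 for all large t.

For the latter, f' has integral S = S(f) ≠ 0, because f minus a primitive of f' is a step function
(`integral_deriv_eq_sumOfJumps`). Over an irrational rotation, f' = S + (coboundary of a bounded q)
+ r with r small in L¹ (`exists_coboundary_approx`), so between discontinuities f^(j) has slope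
about jS (`abs_birkhoff_increment_le`). The relevant j are comparable to t and at most N ~ t/c. Cut
the circle into K = LN intervals and discard those that meet a discontinuity of f^(N) or carry too
much of r. On the others each f^(j) oscillates by less than c, while f^(j+1) ≥ f^(j) + c. Hence one
j only can come near t, and its slope confines x to a set of length O(ε/t) (`volume_close_le`).
Summed over about Lt/c intervals this is O(εL), uniformly in t. -/

/-! ### Absolute continuity on open intervals, and step functions -/

theorem AbsContOnIoo.uniformContinuousOn {F : ℝ → ℝ} {a b : ℝ} (h : AbsContOnIoo F a b) :
    UniformContinuousOn F (Ioo a b) := by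
  rw [Metric.uniformContinuousOn_iff]
  intro ε hε
  obtain ⟨δ, hδ, H⟩ := h ε hε
  have key : ∀ x ∈ Ioo a b, ∀ y ∈ Ioo a b, x ≤ y → dist x y < δ → dist (F x) (F y) < ε := by
    intro x hx y hy hxy hd
    have := H 1 (fun _ => x) (fun _ => y) (fun _ => ⟨hx, hy, hxy⟩)
      (fun i j hij => (hij (Subsingleton.elim i j)).elim)
      (by rw [dist_comm, Real.dist_eq, abs_of_nonneg (sub_nonneg.2 hxy)] at hd; simpa using hd)
    rw [dist_comm, Real.dist_eq]
    simpa using this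
  refine ⟨δ, hδ, fun x hx y hy hd => ?_⟩
  rcases le_total x y with hxy | hxy
  · exact key x hx y hy hxy hd
  · rw [dist_comm] at hd ⊢
    exact key y hy x hx hxy hd

theorem exists_tendsto_of_uniformContinuousOn {F : ℝ → ℝ} {s : Set ℝ}
    (h : UniformContinuousOn F s) {x : ℝ} (hx : x ∈ closure s) :
    ∃ y, Tendsto F (𝓝[s] x) (𝓝 y) := by
  have : (𝓝[s] x).NeBot := mem_closure_iff_nhdsWithin_neBot.1 hx
  exact CompleteSpace.complete
    ((cauchy_nhds.mono' this nhdsWithin_le_nhds).map_of_le h inf_le_right)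

/-- A function that is absolutely continuous on an open interval agrees there with a function that
is absolutely continuous on the closed interval. -/
theorem AbsContOnIoo.exists_extension {F : ℝ → ℝ} {a b : ℝ} (hab : a < b)
    (h : AbsContOnIoo F a b) :
    ∃ g : ℝ → ℝ, AbsolutelyContinuousOnInterval g a b ∧ EqOn g F (Ioo a b) := by
  have hu := h.uniformContinuousOn
  have hcl : closure (Ioo a b) = Icc a b := closure_Ioo hab.ne
  obtain ⟨la, hla⟩ := exists_tendsto_of_uniformContinuousOn hu
    (x := a) (by rw [hcl]; exact left_mem_Icc.2 hab.le)
  obtain ⟨lb, hlb⟩ := exists_tendsto_of_uniformContinuousOn hu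
    (x := b) (by rw [hcl]; exact right_mem_Icc.2 hab.le)
  rw [nhdsWithin_Ioo_eq_nhdsGT hab] at hla
  rw [nhdsWithin_Ioo_eq_nhdsLT hab] at hlb
  set g := extendFrom (Ioo a b) F with hg
  have hgc : ContinuousOn g (Icc a b) :=
    continuousOn_Icc_extendFrom_Ioo hu.continuousOn hla hlb
  have hgF : EqOn g F (Ioo a b) := fun x hx =>
    extendFrom_eq (subset_closure hx) (hu.continuousOn x hx)
  refine ⟨g, ?_, hgF⟩
  rw [absolutelyContinuousOnInterval_iff]
  intro ε hε
  -- The intervals to be tested may touch a or b, where the hypothesis says nothing. The bound is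
  -- obtained inside and passed to the limit, which loses strictness; hence ε / 2.
  obtain ⟨δ, hδ, H⟩ := h (ε / 2) (half_pos hε)
  refine ⟨δ, hδ, ?_⟩
  rintro ⟨n, I⟩ ⟨hI, hdis⟩ hlen
  simp only [uIcc_of_le hab.le, Finset.mem_range] at hI
  simp only at hlen
  -- contract the intervals towards the midpoint
  set m := (a + b) / 2 with hm
  set r : ℝ → ℝ → ℝ := fun s x => m + s * (x - m) with hr
  have hrI : ∀ s ∈ Ioo (0 : ℝ) 1, ∀ x ∈ Icc a b, r s x ∈ Ioo a b := by
    rintro s ⟨hs0, hs1⟩ x ⟨hx1, hx2⟩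
    constructor
    · simp only [hr]
      have : s * (m - x) ≤ s * (m - a) := by gcongr
      have : s * (m - a) < 1 * (m - a) := by gcongr; rw [hm]; linarith
      linarith
    · simp only [hr]
      have : s * (x - m) ≤ s * (b - m) := by gcongr
      have : s * (b - m) < 1 * (b - m) := by gcongr; rw [hm]; linarith
      linarith
  have hrm : ∀ s ∈ Ioo (0 : ℝ) 1, StrictMono (r s) := by
    intro s hs x y hxy
    simp only [hr]
    have := mul_lt_mul_of_pos_left hxy hs.1
    linarith
  have key : ∀ s ∈ Ioo (0 : ℝ) 1,
      ∑ i ∈ Finset.range n, dist (g (r s (I i).1)) (g (r s (I i).2)) ≤ ε / 2 := by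
    intro s hs
    have hmono := hrm s hs
    -- Mathlib's pairs of endpoints are unordered, those of `AbsContOnIoo` ordered.
    have hH := H n (fun i => r s (min (I i).1 (I i).2)) (fun i => r s (max (I i).1 (I i).2))
      (fun i => ⟨hrI s hs _ (by
          rcases min_choice (I i).1 (I i).2 with h | h <;> rw [h]
          exacts [(hI i i.2).1, (hI i i.2).2]), hrI s hs _ (by
          rcases max_choice (I i).1 (I i).2 with h | h <;> rw [h]
          exacts [(hI i i.2).1, (hI i i.2).2]), hmono.monotone min_le_max⟩)
      (by
        intro i j hij
        have hd := hdis (by simp) (by simp) (fun e => hij (Fin.ext e) : (i : ℕ) ≠ j)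
        rw [Function.onFun, Set.disjoint_left] at hd
        rw [Set.disjoint_left]
        rintro y ⟨h1, h2⟩ ⟨h3, h4⟩
        set x := m + (y - m) / s with hx
        have hyx : y = r s x := by
          simp only [hr, hx]
          field_simp [hs.1.ne']
          ring
        rw [hyx, hmono.lt_iff_lt] at h1 h2 h3 h4
        exact hd (a := x) ⟨h1, h2.le⟩ ⟨h3, h4.le⟩)
      (by
        refine lt_of_le_of_lt ?_ hlen
        rw [← Fin.sum_univ_eq_sum_range (fun i => dist (I i).1 (I i).2) n]
        refine Finset.sum_le_sum fun i _ => ?_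
        simp only [hr]
        rw [Real.dist_eq, ← max_sub_min_eq_abs']
        have : (0 : ℝ) ≤ max (I i).1 (I i).2 - min (I i).1 (I i).2 := sub_nonneg.2 min_le_max
        nlinarith [hs.2])
    rw [← Fin.sum_univ_eq_sum_range (fun i => dist (g (r s (I i).1)) (g (r s (I i).2))) n]
    refine le_trans (le_of_eq (Finset.sum_congr rfl fun i _ => ?_)) hH.le
    rw [hgF (hrI s hs _ (hI i i.2).1), hgF (hrI s hs _ (hI i i.2).2)]
    rcases le_total (I i).1 (I i).2 with h | h
    · rw [min_eq_left h, max_eq_right h, dist_comm, Real.dist_eq]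
    · rw [min_eq_right h, max_eq_left h, Real.dist_eq]
  have hev : ∀ᶠ s in 𝓝[<] (1 : ℝ), s ∈ Ioo (0 : ℝ) 1 := Ioo_mem_nhdsLT one_pos
  have hlim : ∀ x ∈ Icc a b, Tendsto (fun s => g (r s x)) (𝓝[<] 1) (𝓝 (g x)) := by
    intro x hx
    refine (hgc x hx).tendsto.comp (tendsto_nhdsWithin_iff.2 ⟨?_, ?_⟩)
    · have : Continuous fun s => r s x := by fun_prop
      have h1 : r 1 x = x := by simp [hr]
      have := this.tendsto 1
      rw [h1] at this
      exact this.mono_left nhdsWithin_le_nhds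
    · filter_upwards [hev] with s hs using Ioo_subset_Icc_self (hrI s hs x hx)
  have hsum : Tendsto (fun s => ∑ i ∈ Finset.range n, dist (g (r s (I i).1)) (g (r s (I i).2)))
      (𝓝[<] (1 : ℝ)) (𝓝 (∑ i ∈ Finset.range n, dist (g (I i).1) (g (I i).2))) := by
    refine tendsto_finsetSum _ fun i hi => ?_
    rw [Finset.mem_range] at hi
    exact (hlim _ (hI i hi).1).dist (hlim _ (hI i hi).2)
  exact lt_of_le_of_lt (le_of_tendsto hsum (hev.mono key)) (half_lt_self hε)

/-- The increment of a step function with finitely many jumps is the sum of its jumps. -/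
theorem sub_eq_sum_jumps (D L R : ℝ → ℝ) (P : Finset ℝ) :
    ∀ a b : ℝ, a < b → (∀ p ∈ P, p ∈ Ioo a b) →
      (∀ x y, a ≤ x → x ≤ y → y ≤ b → (∀ p ∈ P, p ∉ Icc x y) → D x = D y) →
      (∀ p ∈ P, Tendsto D (𝓝[<] p) (𝓝 (L p)) ∧ Tendsto D (𝓝[>] p) (𝓝 (R p))) →
      D b - D a = ∑ p ∈ P, (R p - L p) := by
  induction P using Finset.induction_on_max with
  | empty =>
    intro a b hab _ hD _
    rw [hD a b le_rfl hab.le le_rfl (by simp)]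
    simp
  | insert m P hm ih =>
    intro a b hab hP hD hlim
    have hmP : m ∉ P := fun h => lt_irrefl _ (hm m h)
    have hmI := hP m (Finset.mem_insert_self _ _)
    -- The point c separates the last jump m from the earlier ones: D is constant on [c, m) and on
    -- (m, b].
    obtain ⟨c, hac, hcm, hPc⟩ : ∃ c, a < c ∧ c < m ∧ ∀ p ∈ P, p < c := by
      rcases P.eq_empty_or_nonempty with rfl | hne
      · obtain ⟨c, h1, h2⟩ := exists_between hmI.1
        exact ⟨c, h1, h2, by simp⟩
      · have h1 := hm _ (P.max'_mem hne)
        obtain ⟨c, h2, h3⟩ := exists_between h1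
        refine ⟨c, ?_, h3, fun p hp => (P.le_max' p hp).trans_lt h2⟩
        exact ((hP _ (Finset.mem_insert_of_mem (P.max'_mem hne))).1).trans h2
    have hIH := ih a c hac
      (fun p hp => ⟨(hP p (Finset.mem_insert_of_mem hp)).1, hPc p hp⟩)
      (fun x y hax hxy hyc hp => hD x y hax hxy (hyc.trans (hcm.trans hmI.2).le) (by
        intro p hp'
        rcases Finset.mem_insert.1 hp' with rfl | hp'
        · exact fun h => absurd (h.2.trans hyc) (not_le.2 hcm)
        · exact hp p hp'))
      (fun p hp => hlim p (Finset.mem_insert_of_mem hp))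
    have hLm : L m = D c := by
      refine tendsto_nhds_unique (hlim m (Finset.mem_insert_self _ _)).1
        (tendsto_const_nhds.congr' ?_)
      filter_upwards [Ioo_mem_nhdsLT hcm] with x hx
      refine hD c x hac.le hx.1.le (hx.2.trans hmI.2).le fun p hp h => ?_
      rcases Finset.mem_insert.1 hp with rfl | hp
      · exact absurd h.2 (not_le.2 hx.2)
      · exact absurd h.1 (not_le.2 (hPc p hp))
    have hRm : R m = D b := by
      refine tendsto_nhds_unique (hlim m (Finset.mem_insert_self _ _)).2
        (tendsto_const_nhds.congr' ?_)
      filter_upwards [Ioo_mem_nhdsGT hmI.2] with x hx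
      refine (hD x b (hmI.1.trans hx.1).le hx.2.le le_rfl fun p hp h => ?_).symm
      rcases Finset.mem_insert.1 hp with rfl | hp
      · exact absurd h.1 (not_le.2 hx.1)
      · exact absurd (h.1.trans (hm p hp).le) (not_le.2 hx.1)
    rw [Finset.sum_insert hmP, ← hIH, hLm, hRm]
    ring

/-! ### Piecewise absolutely continuous functions on the circle -/

/-- Break points are isolated because B is finite. Since x may itself be one, it is removed from B
first; a radius at most 1/2 keeps out the other lifts of x. -/
theorem exists_punctured_arc (B : Finset UnitAddCircle) (x : ℝ) :
    ∃ δ > 0, ∀ y ∈ Ioo (x - δ) (x + δ), y ≠ x → (y : UnitAddCircle) ∉ B := by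
  have hopen : IsOpen ((↑) ⁻¹' ((B.erase (x : UnitAddCircle) : Set UnitAddCircle)ᶜ) : Set ℝ) :=
    (B.erase (x : UnitAddCircle)).finite_toSet.isClosed.isOpen_compl.preimage
      (AddCircle.continuous_mk' 1)
  obtain ⟨δ, hδ, hball⟩ := Metric.isOpen_iff.1 hopen x (by simp)
  refine ⟨min δ (1 / 2), by positivity, fun y hy hne hyB => ?_⟩
  have h1 := min_le_left δ (1 / 2)
  have h2 := min_le_right δ (1 / 2)
  have hmem : y ∈ Metric.ball x δ := by
    rw [Real.ball_eq_Ioo]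
    exact ⟨by linarith [hy.1], by linarith [hy.2]⟩
  have h3 := hball hmem
  have hyx : (y : UnitAddCircle) = x := by
    by_contra hc
    exact h3 (Finset.mem_coe.2 (Finset.mem_erase.2 ⟨hc, hyB⟩))
  refine hne ((AddCircle.coe_eq_coe_iff_of_mem_Ico (p := (1 : ℝ)) (a := x - 1 / 2) ?_ ?_).1 hyx)
  · exact ⟨by linarith [hy.1], by linarith [hy.2]⟩
  · exact ⟨by linarith, by linarith⟩

section

variable {f : UnitAddCircle → ℝ} {B : Finset UnitAddCircle}

/-- Around every point the lift of `f` agrees on either side with an absolutely continuous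
function. -/
theorem PiecewiseAbsCont.exists_local (hfB : PiecewiseAbsCont f B) (x : ℝ) :
    ∃ δ > 0, ∃ l r : ℝ → ℝ,
      AbsolutelyContinuousOnInterval l (x - δ) x ∧
      AbsolutelyContinuousOnInterval r x (x + δ) ∧
      EqOn l (fun y : ℝ => f y) (Ioo (x - δ) x) ∧ EqOn r (fun y : ℝ => f y) (Ioo x (x + δ)) := by
  obtain ⟨δ, hδ, h⟩ := exists_punctured_arc B x
  obtain ⟨l, hl, hl'⟩ := (hfB (x - δ) x (by linarith)
    (fun y hy => h y ⟨hy.1, by linarith [hy.2]⟩ hy.2.ne)).exists_extension (by linarith)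
  obtain ⟨r, hr, hr'⟩ := (hfB x (x + δ) (by linarith)
    (fun y hy => h y ⟨by linarith [hy.1], hy.2⟩ hy.1.ne')).exists_extension (by linarith)
  exact ⟨δ, hδ, l, r, hl, hr, hl', hr'⟩

theorem PiecewiseAbsCont.exists_tendsto (hfB : PiecewiseAbsCont f B) (x : ℝ) :
    (∃ y, Tendsto (fun z : ℝ => f z) (𝓝[<] x) (𝓝 y)) ∧
      ∃ y, Tendsto (fun z : ℝ => f z) (𝓝[>] x) (𝓝 y) := by
  obtain ⟨δ, hδ, l, r, hl, hr, hl', hr'⟩ := hfB.exists_local x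
  have h1 : x - δ < x := by linarith
  have h2 : x < x + δ := by linarith
  constructor
  · refine ⟨l x, Tendsto.congr' (f₁ := l) ?_ ?_⟩
    · filter_upwards [Ioo_mem_nhdsLT h1] with y hy using hl' hy
    · have := hl.continuousOn x right_mem_uIcc
      rw [uIcc_of_le h1.le] at this
      rw [← nhdsWithin_Ioo_eq_nhdsLT h1]
      exact this.tendsto.mono_left (nhdsWithin_mono _ Ioo_subset_Icc_self)
  · refine ⟨r x, Tendsto.congr' (f₁ := r) ?_ ?_⟩
    · filter_upwards [Ioo_mem_nhdsGT h2] with y hy using hr' hy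
    · have := hr.continuousOn x left_mem_uIcc
      rw [uIcc_of_le h2.le] at this
      rw [← nhdsWithin_Ioo_eq_nhdsGT h2]
      exact this.tendsto.mono_left (nhdsWithin_mono _ Ioo_subset_Icc_self)

/-- Near each point, f is bounded by the two one-sided extensions and its value at the point;
compactness of [0, 1] does the rest. -/
theorem PiecewiseAbsCont.exists_bound (hfB : PiecewiseAbsCont f B) : ∃ M, ∀ x, f x ≤ M := by
  have hloc : ∀ x ∈ Icc (0 : ℝ) 1, ∃ t ∈ 𝓝[Icc (0 : ℝ) 1] x,
      ∃ M, ∀ y ∈ t, f (y : UnitAddCircle) ≤ M := by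
    intro x _
    obtain ⟨δ, hδ, l, r, hl, hr, hl', hr'⟩ := hfB.exists_local x
    obtain ⟨C₁, h₁⟩ := hl.exists_bound
    obtain ⟨C₂, h₂⟩ := hr.exists_bound
    rw [uIcc_of_le (by linarith)] at h₁ h₂
    refine ⟨Ioo (x - δ) (x + δ), mem_nhdsWithin_of_mem_nhds
      (Ioo_mem_nhds (by linarith) (by linarith)), max (max C₁ C₂) (f x), fun y hy => ?_⟩
    rcases lt_trichotomy y x with h | rfl | h
    · have h3 := hl' ⟨hy.1, h⟩
      have h4 := h₁ y ⟨hy.1.le, h.le⟩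
      simp only at h3
      rw [← h3]
      exact (le_abs_self _).trans (h4.trans ((le_max_left _ _).trans (le_max_left _ _)))
    · exact le_max_right _ _
    · have h3 := hr' ⟨h, hy.2⟩
      have h4 := h₂ y ⟨h.le, hy.2.le⟩
      simp only at h3
      rw [← h3]
      exact (le_abs_self _).trans (h4.trans ((le_max_right _ _).trans (le_max_left _ _)))
  obtain ⟨M, hM⟩ : ∃ M, ∀ y ∈ Icc (0 : ℝ) 1, f (y : UnitAddCircle) ≤ M := by
    refine isCompact_Icc.induction_on (p := fun s : Set ℝ => ∃ M, ∀ y ∈ s, f (y : UnitAddCircle) ≤ M)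
      ⟨0, by simp⟩ (fun s t hst ⟨M, hM⟩ => ⟨M, fun y hy => hM y (hst hy)⟩) ?_ hloc
    rintro s t ⟨M₁, h₁⟩ ⟨M₂, h₂⟩
    refine ⟨max M₁ M₂, fun y hy => ?_⟩
    rcases hy with hy | hy
    · exact (h₁ y hy).trans (le_max_left _ _)
    · exact (h₂ y hy).trans (le_max_right _ _)
  refine ⟨M, fun x => ?_⟩
  obtain ⟨y, hy, rfl⟩ : x ∈ ((↑) : ℝ → UnitAddCircle) '' Icc 0 (0 + 1) := by
    rw [AddCircle.coe_image_Icc_eq]; trivial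
  exact hM y (by simpa using hy)

theorem PiecewiseAbsCont.measurable (hfB : PiecewiseAbsCont f B) : Measurable f := by
  refine measurable_of_measurable_on_compl_finite (B : Set UnitAddCircle) B.finite_toSet ?_
  refine (ContinuousOn.domRestrict fun z hz => ContinuousAt.continuousWithinAt ?_).measurable
  obtain ⟨x, rfl⟩ := QuotientAddGroup.mk_surjective z
  rw [← QuotientAddGroup.isOpenQuotientMap_mk.continuousAt_comp_iff]
  obtain ⟨δ, hδ, h⟩ := exists_punctured_arc B x
  have hac := hfB (x - δ) (x + δ) (by linarith) (fun y hy => by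
    by_cases hyx : y = x
    · rw [hyx]; exact hz
    · exact h y hy hyx)
  exact (hac.uniformContinuousOn.continuousOn).continuousAt
    (Ioo_mem_nhds (by linarith) (by linarith))

theorem PiecewiseAbsCont.locallyIntegrable_deriv (hfB : PiecewiseAbsCont f B) :
    LocallyIntegrable (deriv fun x : ℝ => f x) := by
  intro x
  obtain ⟨δ, hδ, l, r, hl, hr, hl', hr'⟩ := hfB.exists_local x
  refine ⟨Ioo (x - δ) (x + δ), Ioo_mem_nhds (by linarith) (by linarith), ?_⟩
  have h1 : IntegrableOn (deriv fun x : ℝ => f x) (Ioo (x - δ) x) := by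
    refine IntegrableOn.congr_fun ?_ (hl'.deriv isOpen_Ioo) measurableSet_Ioo
    exact ((intervalIntegrable_iff_integrableOn_Ioo_of_le (by linarith)).1
      hl.intervalIntegrable_deriv)
  have h2 : IntegrableOn (deriv fun x : ℝ => f x) (Ioo x (x + δ)) := by
    refine IntegrableOn.congr_fun ?_ (hr'.deriv isOpen_Ioo) measurableSet_Ioo
    exact ((intervalIntegrable_iff_integrableOn_Ioo_of_le (by linarith)).1
      hr.intervalIntegrable_deriv)
  have h3 : IntegrableOn (deriv fun x : ℝ => f x) {x} :=
    integrableOn_singleton (by simp) (by rw [Real.volume_singleton]; exact ENNReal.zero_lt_top)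
  refine ((h1.union h3).union h2).mono_set fun y hy => ?_
  rcases lt_trichotomy y x with h | rfl | h
  · exact Or.inl (Or.inl ⟨hy.1, h⟩)
  · exact Or.inl (Or.inr rfl)
  · exact Or.inr ⟨h, hy.2⟩

theorem PiecewiseAbsCont.intervalIntegrable_deriv (hfB : PiecewiseAbsCont f B) (a b : ℝ) :
    IntervalIntegrable (deriv fun x : ℝ => f x) volume a b :=
  (LocallyIntegrable.integrableOn_isCompact hfB.locallyIntegrable_deriv
    isCompact_uIcc).intervalIntegrable

/-- A closed interval free of break points sits in a slightly larger open one with the same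
property, so the fundamental theorem for absolutely continuous functions applies up to the
endpoints. -/
theorem PiecewiseAbsCont.integral_deriv (hfB : PiecewiseAbsCont f B) {x y : ℝ} (hxy : x ≤ y)
    (h : ∀ z ∈ Icc x y, (z : UnitAddCircle) ∉ B) :
    ∫ z in x..y, deriv (fun x : ℝ => f x) z = f y - f x := by
  obtain ⟨δ₁, h₁, hx⟩ := exists_punctured_arc B x
  obtain ⟨δ₂, h₂, hy⟩ := exists_punctured_arc B y
  obtain ⟨g, hg, hgF⟩ := (hfB (x - δ₁) (y + δ₂) (by linarith) (fun z hz => by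
    rcases lt_or_ge z x with hzx | hzx
    · exact hx z ⟨hz.1, by linarith⟩ hzx.ne
    rcases lt_or_ge y z with hzy | hzy
    · exact hy z ⟨by linarith, hz.2⟩ hzy.ne'
    · exact h z ⟨hzx, hzy⟩)).exists_extension (by linarith)
  have hsub : Icc x y ⊆ Ioo (x - δ₁) (y + δ₂) :=
    fun z hz => ⟨by linarith [hz.1], by linarith [hz.2]⟩
  have hgxy : AbsolutelyContinuousOnInterval g x y := hg.mono (by
    rw [uIcc_of_le hxy, uIcc_of_le (by linarith)]
    exact hsub.trans Ioo_subset_Icc_self)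
  have h3 := hgxy.integral_deriv_eq_sub
  rw [hgF (hsub (left_mem_Icc.2 hxy)), hgF (hsub (right_mem_Icc.2 hxy))] at h3
  rw [← h3]
  refine intervalIntegral.integral_congr fun z hz => ?_
  rw [uIcc_of_le hxy] at hz
  exact ((hgF.deriv isOpen_Ioo) (hsub hz)).symm

theorem tendsto_leftLimit (hfB : PiecewiseAbsCont f B) (x : ℝ) :
    Tendsto (fun z : ℝ => f z) (𝓝[<] x) (𝓝 (leftLimit f x)) := by
  obtain ⟨y, hy⟩ := (hfB.exists_tendsto x).1
  have : Tendsto (fun h : ℝ => f ((x : UnitAddCircle) + (h : UnitAddCircle))) (𝓝[<] 0) (𝓝 y) := by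
    have h1 : Tendsto (fun h : ℝ => x + h) (𝓝[<] 0) (𝓝[<] x) := by
      refine tendsto_nhdsWithin_iff.2 ⟨?_, ?_⟩
      · have : Continuous fun h : ℝ => x + h := by fun_prop
        have := this.tendsto 0
        rw [add_zero] at this
        exact this.mono_left nhdsWithin_le_nhds
      · filter_upwards [self_mem_nhdsWithin] with h hh
        simpa using hh
    simpa [Function.comp_def] using hy.comp h1
  rw [leftLimit, this.limUnder_eq]
  exact hy

theorem tendsto_rightLimit (hfB : PiecewiseAbsCont f B) (x : ℝ) :
    Tendsto (fun z : ℝ => f z) (𝓝[>] x) (𝓝 (rightLimit f x)) := by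
  obtain ⟨y, hy⟩ := (hfB.exists_tendsto x).2
  have : Tendsto (fun h : ℝ => f ((x : UnitAddCircle) + (h : UnitAddCircle))) (𝓝[>] 0) (𝓝 y) := by
    have h1 : Tendsto (fun h : ℝ => x + h) (𝓝[>] 0) (𝓝[>] x) := by
      refine tendsto_nhdsWithin_iff.2 ⟨?_, ?_⟩
      · have : Continuous fun h : ℝ => x + h := by fun_prop
        have := this.tendsto 0
        rw [add_zero] at this
        exact this.mono_left nhdsWithin_le_nhds
      · filter_upwards [self_mem_nhdsWithin] with h hh
        simpa using hh
    simpa [Function.comp_def] using hy.comp h1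
  rw [rightLimit, this.limUnder_eq]
  exact hy

theorem exists_lift_notMem (B : Finset UnitAddCircle) : ∃ a : ℝ, (a : UnitAddCircle) ∉ B := by
  obtain ⟨δ, hδ, h⟩ := exists_punctured_arc B 0
  exact ⟨δ / 2, h _ ⟨by linarith, by linarith⟩ (by positivity)⟩

theorem periodic_deriv (f : UnitAddCircle → ℝ) :
    Function.Periodic (deriv fun x : ℝ => f x) 1 := by
  intro x
  have h := deriv_comp_add_const (f := fun x : ℝ => f x) (a := 1) (x := x)
  rw [← h]
  congr 1
  ext y
  congr 1
  simp

/-- The integral of the derivative over the circle is the sum of the jumps. -/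
theorem PiecewiseAbsCont.integral_deriv_eq_sumOfJumps (hfB : PiecewiseAbsCont f B) :
    ∫ z in (0 : ℝ)..1, deriv (fun x : ℝ => f x) z = sumOfJumps f B := by
  set φ := deriv fun x : ℝ => f x with hφ
  have hint : ∀ a b, IntervalIntegrable φ volume a b := hfB.intervalIntegrable_deriv
  obtain ⟨a, ha⟩ := exists_lift_notMem B
  have ha1 : ((a + 1 : ℝ) : UnitAddCircle) = a := AddCircle.coe_add_period (1 : ℝ) a
  set lift : UnitAddCircle → ℝ := fun β => (AddCircle.equivIoc (1 : ℝ) a β : ℝ) with hlift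
  have hlift_coe : ∀ β, (lift β : UnitAddCircle) = β := fun β => AddCircle.coe_equivIoc
  have hlift_mem : ∀ β, lift β ∈ Ioc a (a + 1) := fun β => (AddCircle.equivIoc (1 : ℝ) a β).2
  have hinj : Function.Injective lift := fun β γ h => by
    rw [← hlift_coe β, ← hlift_coe γ, h]
  set Φ : ℝ → ℝ := fun x => ∫ z in a..x, φ z with hΦ
  have hΦc : Continuous Φ := intervalIntegral.continuous_primitive hint a
  -- Subtracting the continuous primitive Φ leaves a step function with the jumps of f. As f(a + 1)
  -- = f(a), its total increment over the period is -Φ(a + 1).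
  have key := sub_eq_sum_jumps (fun x => f x - Φ x) (fun p => leftLimit f p - Φ p)
    (fun p => rightLimit f p - Φ p) (B.image lift) a (a + 1) (by linarith) ?_ ?_ ?_
  · rw [Finset.sum_image hinj.injOn] at key
    simp only [hlift_coe, ha1] at key
    have h1 : Φ a = 0 := intervalIntegral.integral_same
    have h2 : Φ (a + 1) = ∫ z in (0 : ℝ)..1, φ z := by
      have := (periodic_deriv f).intervalIntegral_add_eq a 0
      simpa using this
    rw [← h2, sumOfJumps]
    have h3 : ∀ β ∈ B, rightLimit f β - Φ (lift β) - (leftLimit f β - Φ (lift β))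
        = -(leftLimit f β - rightLimit f β) := fun β _ => by ring
    rw [Finset.sum_congr rfl h3, Finset.sum_neg_distrib] at key
    linarith
  · intro p hp
    obtain ⟨β, hβ, rfl⟩ := Finset.mem_image.1 hp
    refine ⟨(hlift_mem β).1, lt_of_le_of_ne (hlift_mem β).2 fun h => ?_⟩
    rw [← hlift_coe β, h, ha1] at hβ
    exact ha hβ
  · intro x y hax hxy hyb hP
    have := hfB.integral_deriv hxy (fun z hz hzB => by
      -- The left endpoint is treated apart because `lift` takes its class to a + 1.
      rcases eq_or_lt_of_le (hax.trans hz.1) with h | h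
      · exact ha (h ▸ hzB)
      · refine hP (lift z) (Finset.mem_image_of_mem _ hzB) ?_
        have : lift (z : UnitAddCircle) = z := by
          have hz' : z ∈ Ioc a (a + 1) := ⟨h, hz.2.trans hyb⟩
          exact AddCircle.equivIoc_coe_of_mem hz'
        rwa [this])
    have h4 : Φ y - Φ x = f y - f x := by
      rw [← this]
      exact intervalIntegral.integral_interval_sub_left (hint _ _) (hint _ _)
    linarith
  · intro p _
    exact ⟨(tendsto_leftLimit hfB p).sub (hΦc.continuousAt.tendsto.mono_left nhdsWithin_le_nhds),
      (tendsto_rightLimit hfB p).sub (hΦc.continuousAt.tendsto.mono_left nhdsWithin_le_nhds)⟩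

end

/-! ### Approximation by coboundaries over an irrational rotation -/

theorem volume_eq_haarAddCircle :
    (volume : Measure UnitAddCircle) = AddCircle.haarAddCircle := by
  rw [AddCircle.volume_eq_smul_haarAddCircle]
  simp

/-- For an irrational rotation every trigonometric polynomial is a constant plus a coboundary. -/
theorem exists_coboundary_of_mem_span {α : UnitAddCircle} (hα : addOrderOf α = 0)
    {P : C(UnitAddCircle, ℂ)} (hP : P ∈ Submodule.span ℂ (range (@fourier 1))) :
    ∃ (m : ℂ) (Q : C(UnitAddCircle, ℂ)), ∀ x, P x = m + (Q (x + α) - Q x) := by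
  induction hP using Submodule.span_induction with
  | mem P hP =>
    obtain ⟨n, rfl⟩ := hP
    rcases eq_or_ne n 0 with rfl | hn
    · exact ⟨1, 0, fun x => by simp⟩
    -- Infinite order of α rules out small divisors equal to zero, so the character divided by this
    -- number is a transfer function.
    · have hne : fourier n α - 1 ≠ 0 := by
        intro h
        have h1 : (AddCircle.toCircle (n • α) : ℂ) = 1 := by
          rw [← fourier_apply]; exact sub_eq_zero.1 h
        have h2 : AddCircle.toCircle (n • α) = AddCircle.toCircle (0 : UnitAddCircle) := by
          rw [AddCircle.toCircle_zero]
          exact Circle.ext h1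
        have h3 := AddCircle.injective_toCircle one_ne_zero h2
        rw [← addOrderOf_dvd_iff_zsmul_eq_zero, hα] at h3
        exact hn (by simpa using h3)
      refine ⟨0, (fourier n α - 1)⁻¹ • fourier n, fun x => ?_⟩
      have h4 : fourier n (x + α) = fourier n x * fourier n α := by
        simp only [fourier_apply, smul_add, AddCircle.toCircle_add, Circle.coe_mul]
      simp only [ContinuousMap.smul_apply, smul_eq_mul, h4]
      field_simp
      ring
  | zero => exact ⟨0, 0, fun x => by simp⟩
  | add P₁ P₂ _ _ h₁ h₂ =>
    obtain ⟨m₁, Q₁, h₁⟩ := h₁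
    obtain ⟨m₂, Q₂, h₂⟩ := h₂
    refine ⟨m₁ + m₂, Q₁ + Q₂, fun x => ?_⟩
    simp only [ContinuousMap.add_apply, h₁, h₂]
    ring
  | smul c P _ h =>
    obtain ⟨m, Q, h⟩ := h
    refine ⟨c * m, c • Q, fun x => ?_⟩
    simp only [ContinuousMap.smul_apply, smul_eq_mul, h]
    ring

/-- For an irrational rotation, continuous coboundaries are dense in the integrable functions of
zero mean. -/
theorem exists_coboundary_approx {α : UnitAddCircle} (hα : addOrderOf α = 0)
    {ψ : UnitAddCircle → ℝ} (hψ : Integrable ψ) {ε : ℝ} (hε : 0 < ε) :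
    ∃ Q : C(UnitAddCircle, ℝ), ∫ x, |ψ x - (∫ y, ψ y) - (Q (x + α) - Q x)| < ε := by
  have : IsProbabilityMeasure (volume : Measure UnitAddCircle) := ⟨UnitAddCircle.measure_univ⟩
  have hψ' : Integrable (fun x => (ψ x : ℂ)) AddCircle.haarAddCircle := by
    rw [← volume_eq_haarAddCircle]; exact hψ.ofReal
  have hmem : hψ'.toL1 ∈ (Submodule.span ℂ (range (@fourierLp 1 _ 1 _))).topologicalClosure := by
    rw [span_fourierLp_closure_eq_top ENNReal.one_ne_top]; trivial
  obtain ⟨g, hg, hdist⟩ := Metric.mem_closure_iff.1 hmem (ε / 2) (half_pos hε)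
  have hspan : Submodule.span ℂ (range (@fourierLp 1 _ 1 _)) =
      (Submodule.span ℂ (range (@fourier 1))).map
        (ContinuousMap.toLp (E := ℂ) 1 (@AddCircle.haarAddCircle 1 _) ℂ).toLinearMap := by
    rw [Submodule.map_span, ← range_comp]
    rfl
  obtain ⟨P, hP, rfl⟩ : ∃ P ∈ Submodule.span ℂ (range (@fourier 1)),
      ContinuousMap.toLp (E := ℂ) 1 (@AddCircle.haarAddCircle 1 _) ℂ P = g := by
    have : g ∈ Submodule.span ℂ (range (@fourierLp 1 _ 1 _)) := hg
    rw [hspan] at this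
    exact this
  have hPint : ∀ R : C(UnitAddCircle, ℂ), Integrable R := fun R =>
    R.continuous.integrable_of_hasCompactSupport (HasCompactSupport.of_compactSpace R)
  have hclose : ∫ x, ‖(ψ x : ℂ) - P x‖ < ε / 2 := by
    rw [dist_eq_norm, L1.norm_eq_integral_norm] at hdist
    rw [volume_eq_haarAddCircle]
    refine lt_of_le_of_lt (le_of_eq (integral_congr_ae ?_)) hdist
    filter_upwards [Lp.coeFn_sub hψ'.toL1 (ContinuousMap.toLp (E := ℂ) 1
      (@AddCircle.haarAddCircle 1 _) ℂ P), hψ'.coeFn_toL1,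
      ContinuousMap.coeFn_toLp (p := 1) (𝕜 := ℂ) (@AddCircle.haarAddCircle 1 _) P]
      with x h1 h2 h3
    rw [h1, Pi.sub_apply, h2, h3]
  obtain ⟨m, Q, hQ⟩ := exists_coboundary_of_mem_span hα hP
  have hψc : Integrable (fun x => (ψ x : ℂ)) := hψ.ofReal
  have hmean : ∫ x : UnitAddCircle, P x = m := by
    simp only [hQ]
    have h1 : Integrable (fun x => Q (x + α)) := (hPint Q).comp_add_right α
    have h2 : ∫ x, (Q (x + α) - Q x) = 0 := by
      rw [integral_sub h1 (hPint Q), integral_add_right_eq_self (fun x => Q x), sub_self]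
    have h3 : Integrable (fun x => Q (x + α) - Q x) := h1.sub (hPint Q)
    rw [integral_add (integrable_const _) h3, h2, integral_const, probReal_univ]
    simp
  -- The constant m is the mean of P, as coboundaries integrate to zero; replacing it by the mean of
  -- ψ costs the other half of ε.
  have hm : ‖(∫ y, (ψ y : ℂ)) - m‖ ≤ ε / 2 := by
    rw [← hmean, ← integral_sub hψc (hPint P)]
    exact (norm_integral_le_integral_norm _).trans hclose.le
  refine ⟨⟨fun x => (Q x).re, Complex.continuous_re.comp Q.continuous⟩, ?_⟩
  have hbound : ∀ x, |ψ x - (∫ y, ψ y) - ((Q (x + α)).re - (Q x).re)|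
      ≤ ‖(ψ x : ℂ) - P x‖ + ‖(∫ y, (ψ y : ℂ)) - m‖ := by
    intro x
    have e : ψ x - (∫ y, ψ y) - ((Q (x + α)).re - (Q x).re)
        = ((ψ x : ℂ) - P x - ((∫ y, (ψ y : ℂ)) - m)).re := by
      rw [hQ x, integral_complex_ofReal]
      simp
      ring
    rw [e]
    exact (Complex.abs_re_le_norm _).trans (norm_sub_le _ _)
  have hi : Integrable fun x => ‖(ψ x : ℂ) - P x‖ := (hψc.sub (hPint P)).norm
  calc ∫ x, |ψ x - (∫ y, ψ y) - ((Q (x + α)).re - (Q x).re)|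
      ≤ ∫ x, (‖(ψ x : ℂ) - P x‖ + ‖(∫ y, (ψ y : ℂ)) - m‖) :=
        integral_mono_of_nonneg (ae_of_all _ fun _ => abs_nonneg _)
          (hi.add (integrable_const _)) (ae_of_all _ hbound)
    _ = (∫ x, ‖(ψ x : ℂ) - P x‖) + ‖(∫ y, (ψ y : ℂ)) - m‖ := by
        rw [integral_add hi (integrable_const _), integral_const, probReal_univ, one_smul]
    _ < ε := by linarith

/-- The version of `exists_coboundary_approx` for periodic functions on the line. -/
theorem exists_coboundary_approx_periodic {a : ℝ} (ha : addOrderOf (a : UnitAddCircle) = 0)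
    {φ : ℝ → ℝ} (hφ : Function.Periodic φ 1) (hint : IntervalIntegrable φ volume 0 1)
    {ε : ℝ} (hε : 0 < ε) :
    ∃ (q : ℝ → ℝ) (C : ℝ), Continuous q ∧ (∀ x, |q x| ≤ C) ∧
      (∀ x, q (x + 1) = q x) ∧
      ∫ x in (0 : ℝ)..1, |φ x - (∫ y in (0 : ℝ)..1, φ y) - (q (x + a) - q x)| < ε := by
  have hψ : Integrable (hφ.lift : UnitAddCircle → ℝ) := by
    have hmp : MeasurePreserving (fun x => (AddCircle.equivIoc (1 : ℝ) 0 x : ℝ)) volume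
        (volume.restrict (Ioc (0 : ℝ) (0 + 1))) :=
      (measurePreserving_subtype_coe measurableSet_Ioc).comp
        (AddCircle.measurePreserving_equivIoc 1)
    have hφ0 : Integrable φ (volume.restrict (Ioc (0 : ℝ) (0 + 1))) := by
      rw [zero_add]
      exact (intervalIntegrable_iff_integrableOn_Ioc_of_le zero_le_one).1 hint
    refine (hmp.integrable_comp_of_integrable hφ0).congr (ae_of_all _ fun x => ?_)
    conv_rhs => rw [← AddCircle.coe_equivIoc (p := (1 : ℝ)) (a := 0) (y := x)]
    rw [hφ.lift_coe]
    rfl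
  obtain ⟨Q, hQ⟩ := exists_coboundary_approx ha hψ hε
  refine ⟨fun x => Q x, ‖Q‖, Q.continuous.comp (AddCircle.continuous_mk' 1),
    fun x => Q.norm_coe_le_norm _, fun x => by simp, ?_⟩
  rw [← UnitAddCircle.intervalIntegral_preimage 0, ← UnitAddCircle.intervalIntegral_preimage 0]
    at hQ
  simpa using hQ

/-! ### Level sets of families of nearly linear functions -/

/-- If the functions `G j` are `c`-separated and, up to a small error, have slope `j * S` on a short
set `I`, then only one of them comes close to a given level `t` on `I`, and only on a set of small
diameter. -/
theorem volume_close_le {G : ℕ → ℝ → ℝ} {I E : Set ℝ} {c S C v ε t ℓ J : ℝ} {N : ℕ}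
    (hc : 0 < c) (hG : ∀ j x, G j x + c ≤ G (j + 1) x)
    (hinc : ∀ j ≤ N, ∀ x ∈ I, ∀ y ∈ I, x ≤ y →
      |G j y - G j x - j * S * (y - x)| ≤ 2 * C * (y - x) + v)
    (hℓ : ∀ x ∈ I, ∀ y ∈ I, y - x ≤ ℓ) (hC : 0 ≤ C) (hv : v ≤ ε)
    (hosc : N * |S| * ℓ + 2 * C * ℓ + 3 * ε < c) (hJ : 0 < J * |S| - 2 * C)
    (hE : ∀ x ∈ E ∩ I, ∃ j ≤ N, J ≤ j ∧ |G j x - t| < ε) :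
    volume (E ∩ I) ≤ ENNReal.ofReal (3 * ε / (J * |S| - 2 * C)) := by
  have hsep : ∀ j j' : ℕ, j < j' → ∀ x, G j x + c ≤ G j' x := by
    intro j j' hjj x
    obtain ⟨k, rfl⟩ := Nat.exists_eq_add_of_lt hjj
    induction k with
    | zero => exact hG j x
    | succ k ih =>
      have h1 := ih (by omega)
      have h2 := hG (j + k + 1) x
      have e : j + (k + 1) + 1 = j + k + 1 + 1 := by ring
      rw [e]
      linarith
  have hslope : ∀ j ≤ N, ∀ x ∈ I, ∀ y ∈ I, x ≤ y →
      |G j y - G j x| ≤ N * |S| * ℓ + 2 * C * ℓ + ε := by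
    intro j hj x hx y hy hxy
    have h1 := hinc j hj x hx y hy hxy
    have h2 := hℓ x hx y hy
    have h0 : 0 ≤ y - x := sub_nonneg.2 hxy
    have h3 : |(j : ℝ) * S * (y - x)| ≤ N * |S| * ℓ := by
      rw [abs_mul, abs_mul, abs_of_nonneg h0, Nat.abs_cast]
      gcongr
    have h4 : 2 * C * (y - x) ≤ 2 * C * ℓ := by gcongr
    have h5 := abs_sub_abs_le_abs_sub (G j y - G j x) ((j : ℝ) * S * (y - x))
    linarith
  have key : ∀ x ∈ E ∩ I, ∀ y ∈ E ∩ I, x ≤ y → y - x ≤ 3 * ε / (J * |S| - 2 * C) := by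
    intro x hx y hy hxy
    obtain ⟨j, hj, hJj, hjx⟩ := hE x hx
    obtain ⟨j', hj', -, hjy⟩ := hE y hy
    rw [abs_lt] at hjx hjy
    -- If j < j', then G j' exceeds t + c - ε at x and is below t + ε at y, a drop of more than c -
    -- 2ε, which `hslope` and `hosc` forbid. The case j' < j is symmetric.
    have hjj : j = j' := by
      rcases lt_trichotomy j j' with h | h | h
      · exfalso
        have h1 := hsep j j' h x
        have h2 := (abs_le.1 (hslope j' hj' x hx.2 y hy.2 hxy)).1
        linarith
      · exact h
      · exfalso
        have h1 := hsep j' j h y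
        have h2 := (abs_le.1 (hslope j hj x hx.2 y hy.2 hxy)).2
        linarith
    subst hjj
    have h0 : 0 ≤ y - x := sub_nonneg.2 hxy
    have h1 := hinc j hj x hx.2 y hy.2 hxy
    -- With the error v ≤ ε this makes the 3ε of the conclusion.
    have h2 : |G j y - G j x| < 2 * ε := abs_lt.2 ⟨by linarith, by linarith⟩
    have h3 : |(j : ℝ) * S * (y - x)| = j * |S| * (y - x) := by
      rw [abs_mul, abs_mul, abs_of_nonneg h0, Nat.abs_cast]
    have h4 := abs_sub_abs_le_abs_sub ((j : ℝ) * S * (y - x)) (G j y - G j x)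
    rw [abs_sub_comm ((j : ℝ) * S * (y - x)), h3] at h4
    have h5 : J * |S| * (y - x) ≤ j * |S| * (y - x) := by gcongr
    rw [le_div_iff₀ hJ]
    nlinarith
  refine (Real.volume_le_diam _).trans (Metric.ediam_le fun x hx y hy => ?_)
  rw [edist_dist]
  refine ENNReal.ofReal_le_ofReal ?_
  rcases le_total x y with h | h
  · rw [dist_comm, Real.dist_eq, abs_of_nonneg (sub_nonneg.2 h)]
    exact key x hx y hy h
  · rw [Real.dist_eq, abs_of_nonneg (sub_nonneg.2 h)]
    exact key y hy x hx h

/-- A set that is small on every interval of length `1 / K` which contains none of finitely many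
given points, and on which a given function has small integral, is small. -/
theorem volume_inter_Ico_le {ι : Type*} {K : ℕ} (hK : 0 < K) {E : Set ℝ} {w : ℝ → ℝ}
    (hw : ∀ x, 0 ≤ w x) (hwi : ∀ a b, IntervalIntegrable w volume a b) (T : Finset ι) (p : ι → ℝ)
    {ε η : ℝ} (hε : 0 < ε) (hη : 0 ≤ η)
    (h : ∀ k < K, (∀ i ∈ T, p i ∉ Ico ((k : ℝ) / K) ((k + 1 : ℕ) / K)) →
      (∫ x in ((k : ℝ) / K)..((k + 1 : ℕ) / K), w x) ≤ ε →
      volume (E ∩ Ico ((k : ℝ) / K) ((k + 1 : ℕ) / K)) ≤ ENNReal.ofReal η) :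
    volume (E ∩ Ico 0 1) ≤
      ENNReal.ofReal (K * η + T.card / K + (∫ x in (0 : ℝ)..1, w x) / (K * ε)) := by
  classical
  have hK' : (0 : ℝ) < K := Nat.cast_pos.2 hK
  set I : ℕ → Set ℝ := fun k => Ico ((k : ℝ) / K) ((k + 1 : ℕ) / K) with hI
  set v : ℕ → ℝ := fun k => ∫ x in ((k : ℝ) / K)..((k + 1 : ℕ) / K), w x with hv
  have hle : ∀ k : ℕ, (k : ℝ) / K ≤ (k + 1 : ℕ) / K := fun k => by
    gcongr; exact Nat.le_succ k
  have hv0 : ∀ k, 0 ≤ v k := fun k =>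
    intervalIntegral.integral_nonneg (hle k) fun x _ => hw x
  have hfloor : ∀ k x, x ∈ I k → ⌊x * K⌋ = k := by
    intro k x hx
    rw [Int.floor_eq_iff]
    have h1 := (div_le_iff₀ hK').1 hx.1
    have h2 := (lt_div_iff₀ hK').1 hx.2
    push_cast at h2 ⊢
    exact ⟨h1, h2⟩
  have hcover : E ∩ Ico 0 1 ⊆ ⋃ k ∈ Finset.range K, E ∩ I k := by
    rintro x ⟨hxE, hx0, hx1⟩
    have h0 : 0 ≤ x * K := by positivity
    simp only [mem_iUnion, Finset.mem_range]
    refine ⟨⌊x * K⌋₊, ?_, hxE, ?_, ?_⟩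
    · rw [Nat.floor_lt h0]
      nlinarith
    · rw [div_le_iff₀ hK']
      exact Nat.floor_le h0
    · rw [lt_div_iff₀ hK']
      push_cast
      exact Nat.lt_floor_add_one _
  set n : ℕ → ℝ := fun k => ∑ i ∈ T, if p i ∈ I k then (1 : ℝ) else 0 with hn
  have hn0 : ∀ k, 0 ≤ n k := fun k => Finset.sum_nonneg fun i _ => by split_ifs <;> norm_num
  -- A bad interval is charged its full length 1/K: to n k / K if it contains a marked point,
  -- otherwise, as in Chebyshev's inequality, to v k / (K ε).
  have hpt : ∀ k ∈ Finset.range K,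
      volume (E ∩ I k) ≤ ENNReal.ofReal (η + n k / K + v k / (K * ε)) := by
    intro k hk
    have hlen : volume (E ∩ I k) ≤ ENNReal.ofReal (1 / K) := by
      refine (measure_mono inter_subset_right).trans ?_
      rw [hI, Real.volume_Ico]
      refine ENNReal.ofReal_le_ofReal (le_of_eq ?_)
      push_cast
      ring
    have h1 : 0 ≤ n k / K := div_nonneg (hn0 k) hK'.le
    have h2 : 0 ≤ v k / (K * ε) := div_nonneg (hv0 k) (by positivity)
    by_cases hp : ∀ i ∈ T, p i ∉ I k
    · by_cases hve : v k ≤ ε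
      · exact (h k (Finset.mem_range.1 hk) hp hve).trans (ENNReal.ofReal_le_ofReal (by linarith))
      · refine hlen.trans (ENNReal.ofReal_le_ofReal ?_)
        have : 1 / (K : ℝ) ≤ v k / (K * ε) := by
          rw [div_le_div_iff₀ hK' (by positivity)]
          nlinarith [not_le.1 hve]
        linarith
    · push Not at hp
      obtain ⟨i, hi, hpi⟩ := hp
      refine hlen.trans (ENNReal.ofReal_le_ofReal ?_)
      have h3 : 1 ≤ n k := by
        have := Finset.single_le_sum (f := fun i => if p i ∈ I k then (1 : ℝ) else 0)
          (fun i _ => by split_ifs <;> norm_num) hi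
        simpa [hpi] using this
      have : 1 / (K : ℝ) ≤ n k / K := by gcongr
      linarith
  -- The intervals are disjoint, so each marked point is counted at most once.
  have hnsum : ∑ k ∈ Finset.range K, n k ≤ T.card := by
    rw [hn, Finset.sum_comm, Finset.card_eq_sum_ones, Nat.cast_sum]
    refine Finset.sum_le_sum fun i _ => ?_
    rw [Finset.sum_boole]
    norm_cast
    refine Finset.card_le_one.2 fun k hk k' hk' => ?_
    have h1 := hfloor k _ (Finset.mem_filter.1 hk).2
    have h2 := hfloor k' _ (Finset.mem_filter.1 hk').2
    exact_mod_cast h1.symm.trans h2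
  have hvsum : ∑ k ∈ Finset.range K, v k = ∫ x in (0 : ℝ)..1, w x := by
    have := intervalIntegral.sum_integral_adjacent_intervals (f := w) (μ := volume)
      (a := fun k : ℕ => (k : ℝ) / K) (n := K) fun k _ => hwi _ _
    rw [hv, this]
    simp [hK'.ne']
  calc volume (E ∩ Ico 0 1)
      ≤ volume (⋃ k ∈ Finset.range K, E ∩ I k) := measure_mono hcover
    _ ≤ ∑ k ∈ Finset.range K, volume (E ∩ I k) := measure_biUnion_finset_le _ _
    _ ≤ ∑ k ∈ Finset.range K, ENNReal.ofReal (η + n k / K + v k / (K * ε)) :=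
        Finset.sum_le_sum hpt
    _ = ENNReal.ofReal (∑ k ∈ Finset.range K, (η + n k / K + v k / (K * ε))) := by
        rw [ENNReal.ofReal_sum_of_nonneg]
        intro k _
        have h1 : 0 ≤ n k / K := div_nonneg (hn0 k) hK'.le
        have h2 : 0 ≤ v k / (K * ε) := div_nonneg (hv0 k) (by positivity)
        linarith
    _ ≤ _ := by
        refine ENNReal.ofReal_le_ofReal ?_
        rw [Finset.sum_add_distrib, Finset.sum_add_distrib, ← Finset.sum_div, ← Finset.sum_div,
          hvsum, Finset.sum_const, Finset.card_range, nsmul_eq_mul]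
        gcongr

/-! ### Birkhoff sums over the rotation -/

/-- If the derivative of `F` is a constant `S` plus a coboundary of a bounded function plus a
remainder `r`, then the increments of the Birkhoff sums of `F` are nearly linear. -/
theorem abs_birkhoff_increment_le {F φ q r : ℝ → ℝ} {S C a x y : ℝ} {j N : ℕ} (hjN : j ≤ N)
    (hxy : x ≤ y) (hφ : ∀ z, φ z = S + (q (z + a) - q z) + r z) (hq : Continuous q)
    (hC : ∀ z, |q z| ≤ C) (hr : ∀ b d, IntervalIntegrable r volume b d)
    (hF : ∀ i < N, ∫ z in (x + i * a)..(y + i * a), φ z = F (y + i * a) - F (x + i * a)) :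
    |∑ i ∈ Finset.range j, F (y + i * a) - ∑ i ∈ Finset.range j, F (x + i * a) - j * S * (y - x)|
      ≤ 2 * C * (y - x) + ∫ z in x..y, ∑ i ∈ Finset.range N, |r (z + i * a)| := by
  have hri : ∀ i : ℕ, IntervalIntegrable (fun z => r (z + i * a)) volume x y := fun i => by
    simpa using (hr (x + i * a) (y + i * a)).comp_add_right (i * a)
  have hqi : ∀ b, IntervalIntegrable (fun z => q (z + b)) volume x y := fun b =>
    (hq.comp (continuous_id.add continuous_const)).intervalIntegrable _ _
  have h1 : ∑ i ∈ Finset.range j, F (y + i * a) - ∑ i ∈ Finset.range j, F (x + i * a)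
      = ∫ z in x..y, ∑ i ∈ Finset.range j, φ (z + i * a) := by
    rw [intervalIntegral.integral_finsetSum, ← Finset.sum_sub_distrib]
    · refine Finset.sum_congr rfl fun i hi => ?_
      rw [intervalIntegral.integral_comp_add_right (fun z => φ z),
        hF i ((Finset.mem_range.1 hi).trans_le hjN)]
    · intro i _
      simp only [hφ]
      refine (intervalIntegrable_const.add (IntervalIntegrable.sub ?_ (hqi _))).add (hri i)
      simpa [add_assoc] using hqi (i * a + a)
  -- The coboundary telescopes, so its contribution stays bounded in j.
  have h2 : ∀ (j : ℕ) z, ∑ i ∈ Finset.range j, φ (z + i * a)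
      = j * S + (q (z + j * a) - q z) + ∑ i ∈ Finset.range j, r (z + i * a) := by
    intro j z
    induction j with
    | zero => simp
    | succ j ih =>
      rw [Finset.sum_range_succ, Finset.sum_range_succ, ih, hφ]
      have e : z + ((j + 1 : ℕ) : ℝ) * a = z + j * a + a := by push_cast; ring
      rw [e]
      push_cast
      ring
  have hq0 : IntervalIntegrable (fun z => q z) volume x y := hq.intervalIntegrable _ _
  have hqq : IntervalIntegrable (fun z => q (z + j * a) - q z) volume x y := (hqi _).sub hq0
  have hrs : ∀ n : ℕ, IntervalIntegrable (fun z => ∑ i ∈ Finset.range n, r (z + i * a)) volume x y :=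
    fun n => by
      have := IntervalIntegrable.sum (Finset.range n) fun i _ => hri i
      rwa [Finset.sum_fn] at this
  have hrabs : ∀ n : ℕ,
      IntervalIntegrable (fun z => ∑ i ∈ Finset.range n, |r (z + i * a)|) volume x y := fun n => by
    have := IntervalIntegrable.sum (Finset.range n) fun i _ => (hri i).abs
    rwa [Finset.sum_fn] at this
  have h3 : ∫ z in x..y, ∑ i ∈ Finset.range j, φ (z + i * a)
      = j * S * (y - x) + (∫ z in x..y, (q (z + j * a) - q z))
        + ∫ z in x..y, ∑ i ∈ Finset.range j, r (z + i * a) := by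
    simp only [h2]
    rw [intervalIntegral.integral_add (intervalIntegrable_const.add hqq) (hrs j),
      intervalIntegral.integral_add intervalIntegrable_const hqq, intervalIntegral.integral_const,
      smul_eq_mul]
    ring
  have h4 : |∫ z in x..y, (q (z + j * a) - q z)| ≤ 2 * C * (y - x) := by
    have := intervalIntegral.norm_integral_le_of_norm_le_const (a := x) (b := y) (C := 2 * C)
      (f := fun z => q (z + j * a) - q z) (fun z _ => by
        rw [Real.norm_eq_abs]
        have := abs_sub (q (z + j * a)) (q z)
        linarith [hC (z + j * a), hC z])
    rwa [Real.norm_eq_abs, abs_of_nonneg (sub_nonneg.2 hxy)] at this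
  -- Summing absolute values up to N gives one error term valid for all j ≤ N.
  have h5 : |∫ z in x..y, ∑ i ∈ Finset.range j, r (z + i * a)|
      ≤ ∫ z in x..y, ∑ i ∈ Finset.range N, |r (z + i * a)| := by
    refine (intervalIntegral.abs_integral_le_integral_abs hxy).trans ?_
    refine intervalIntegral.integral_mono_on hxy (hrs j).abs (hrabs N) fun z _ => ?_
    refine (Finset.abs_sum_le_sum_abs _ _).trans ?_
    exact Finset.sum_le_sum_of_subset_of_nonneg (Finset.range_mono hjN) fun _ _ _ => abs_nonneg _
  rw [h1, h3]
  have h6 : ∀ A u v : ℝ, |A + u + v - A| ≤ |u| + |v| := fun A u v => by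
    have : A + u + v - A = u + v := by ring
    rw [this]
    exact abs_add_le u v
  exact (h6 _ _ _).trans (add_le_add h4 h5)

theorem integral_sum_translates {r : ℝ → ℝ} (hper : Function.Periodic r 1)
    (hr : ∀ b d, IntervalIntegrable r volume b d) (a : ℝ) (N : ℕ) :
    ∫ z in (0 : ℝ)..1, ∑ i ∈ Finset.range N, r (z + i * a) = N * ∫ z in (0 : ℝ)..1, r z := by
  rw [intervalIntegral.integral_finsetSum]
  · have : ∀ i ∈ Finset.range N, ∫ z in (0 : ℝ)..1, r (z + i * a) = ∫ z in (0 : ℝ)..1, r z := by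
      intro i _
      rw [intervalIntegral.integral_comp_add_right, add_comm (1 : ℝ), zero_add]
      simpa using hper.intervalIntegral_add_eq (i * a) 0
    rw [Finset.sum_congr rfl this]
    simp
  · intro i _
    simpa using (hr (0 + i * a) (1 + i * a)).comp_add_right (i * a)

section

variable {f : UnitAddCircle → ℝ} {B : Finset UnitAddCircle} {a c : ℝ}

/-- The Birkhoff sums of a piecewise absolutely continuous roof with non-zero sum of jumps come
close to a given large number only on a set of small measure. -/
theorem exists_eventually_volume_close_le (ha : addOrderOf (a : UnitAddCircle) = 0) (hc : 0 < c)
    (hf : ∀ x, c ≤ f x) (hfB : PiecewiseAbsCont f B) (hS : sumOfJumps f B ≠ 0) {u : ℝ}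
    (hu : 0 < u) :
    ∃ ε, 0 < ε ∧ ε < c ∧ ∀ᶠ t : ℝ in atTop,
      volume ({x : ℝ | ∃ j : ℕ, |∑ i ∈ Finset.range j, f ((x + i * a : ℝ) : UnitAddCircle) - t| < ε}
        ∩ Ico 0 1) ≤ ENNReal.ofReal u := by
  obtain ⟨M, hM⟩ := hfB.exists_bound
  have hM0 : 0 < M := hc.trans_le ((hf 0).trans (hM 0))
  set S := sumOfJumps f B with hSdef
  have hS0 : 0 < |S| := abs_pos.2 hS
  -- L is fixed before ε and t. Its first term makes the intervals with discontinuities occupy at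
  -- most u/4, its second makes the linear part N|S|/K of the oscillation at most c/4.
  obtain ⟨L, hL⟩ := exists_nat_gt (4 * B.card / u + 4 * |S| / c + 1)
  have hLB0 : 0 ≤ 4 * B.card / u := by positivity
  have hLS0 : 0 ≤ 4 * |S| / c := by positivity
  have hL1 : (1 : ℝ) ≤ L := by linarith
  have hL0 : (0 : ℝ) < L := by linarith
  have hLB : (B.card : ℝ) / L ≤ u / 4 := by
    have : 4 * B.card / u ≤ L := by linarith
    rw [div_le_iff₀ hu] at this
    rw [div_le_iff₀ hL0]
    linarith
  have hLS : |S| / L ≤ c / 4 := by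
    have : 4 * |S| / c ≤ L := by linarith
    rw [div_le_iff₀ hc] at this
    rw [div_le_iff₀ hL0]
    linarith
  -- The first bound serves the oscillation condition, the second the estimate K η ≤ u/4.
  set ε := min (c / 24) (u * c * |S| / (96 * L * M)) with hεdef
  have hε : 0 < ε := by positivity
  have hεc : ε ≤ c / 24 := min_le_left _ _
  have hεu : ε ≤ u * c * |S| / (96 * L * M) := min_le_right _ _
  have hφi := hfB.intervalIntegrable_deriv
  obtain ⟨q, C, hq, hC, hqper, hqint⟩ := exists_coboundary_approx_periodic ha (periodic_deriv f)
    (hφi 0 1) (show 0 < ε * u / 4 by positivity)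
  rw [hfB.integral_deriv_eq_sumOfJumps, ← hSdef] at hqint
  set φ := deriv fun x : ℝ => f x with hφdef
  set r : ℝ → ℝ := fun x => φ x - S - (q (x + a) - q x) with hrdef
  have hC0 : 0 ≤ C := (abs_nonneg _).trans (hC 0)
  have hri : ∀ b d, IntervalIntegrable r volume b d := fun b d =>
    ((hφi b d).sub intervalIntegrable_const).sub
      (((hq.comp (continuous_id.add continuous_const)).intervalIntegrable _ _).sub
        (hq.intervalIntegrable _ _))
  have hrper : Function.Periodic (fun x => |r x|) 1 := by
    intro x
    have h1 : x + 1 + a = x + a + 1 := by ring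
    simp only [hrdef, hφdef, (periodic_deriv f) x, h1, hqper]
  refine ⟨ε, hε, by linarith, ?_⟩
  -- The thresholds give, in order: N ≤ 2t/c; a contribution of q to the oscillation of at most c/4;
  -- and 2C at most half of J|S|.
  filter_upwards [eventually_ge_atTop (2 * c), eventually_ge_atTop (8 * C),
    eventually_ge_atTop (8 * C * M / |S|)] with t ht1 ht2 ht3
  have ht0 : 0 < t := by linarith
  set N : ℕ := ⌈t / c⌉₊ + 1 with hN
  have hNlow : t / c + 1 ≤ N := by
    rw [hN]; push_cast
    linarith [Nat.le_ceil (t / c)]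
  have hNup : (N : ℝ) ≤ 2 * t / c := by
    have h1 := Nat.ceil_lt_add_one (show 0 ≤ t / c by positivity)
    have h2 : 2 ≤ t / c := by rw [le_div_iff₀ hc]; exact ht1
    have h3 : 2 * t / c = t / c + t / c := by ring
    rw [hN, h3]; push_cast
    linarith
  have hN0 : (0 : ℝ) < N := by positivity
  set K : ℕ := L * N with hK
  have hKr : (K : ℝ) = L * N := by rw [hK]; push_cast; ring
  have hK0 : 0 < K := Nat.cast_pos.1 (show (0 : ℝ) < (K : ℕ) by rw [hKr]; positivity)
  have hKr0 : (0 : ℝ) < K := Nat.cast_pos.2 hK0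
  set J := t / (2 * M) with hJdef
  have hJlow : t * |S| / (4 * M) ≤ J * |S| - 2 * C := by
    rw [div_le_iff₀ hS0] at ht3
    have h1 : J * |S| = t * |S| / (4 * M) + t * |S| / (4 * M) := by rw [hJdef]; field_simp; ring
    have h2 : 2 * C ≤ t * |S| / (4 * M) := by
      rw [le_div_iff₀ (by positivity)]; linarith
    linarith
  have hJ0 : 0 < J * |S| - 2 * C := lt_of_lt_of_le (by positivity) hJlow
  set w : ℝ → ℝ := fun z => ∑ i ∈ Finset.range N, |r (z + i * a)| with hw
  have hw0 : ∀ z, 0 ≤ w z := fun z => Finset.sum_nonneg fun _ _ => abs_nonneg _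
  have hwi : ∀ b d, IntervalIntegrable w volume b d := fun b d => by
    have := IntervalIntegrable.sum (Finset.range N) (f := fun i z => |r (z + (i : ℝ) * a)|)
      (μ := volume) (a := b) (b := d) fun i _ => by
        simpa using ((hri (b + i * a) (d + i * a)).comp_add_right (i * a)).abs
    rwa [Finset.sum_fn] at this
  have hwint : ∫ z in (0 : ℝ)..1, w z ≤ N * (ε * u / 4) := by
    rw [hw, integral_sum_translates hrper (fun b d => (hri b d).abs)]
    gcongr
  -- Lifts to [0, 1) of the points β - iα, the possible discontinuities of the N-th Birkhoff sum.
  set p : ℕ × UnitAddCircle → ℝ := fun s =>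
    (AddCircle.equivIco (1 : ℝ) 0 (s.2 - ((s.1 * a : ℝ) : UnitAddCircle)) : ℝ) with hp
  set η := 3 * ε / (J * |S| - 2 * C) with hη
  refine (volume_inter_Ico_le hK0 hw0 hwi (Finset.range N ×ˢ B) p hε
    (show 0 ≤ η by positivity) ?_).trans (ENNReal.ofReal_le_ofReal ?_)
  · intro k hk hpk hwk
    set I := Ico ((k : ℝ) / K) ((k + 1 : ℕ) / K) with hI
    have hI01 : I ⊆ Ico 0 1 := by
      intro z hz
      refine ⟨le_trans (by positivity) hz.1, hz.2.trans_le ?_⟩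
      rw [div_le_one hKr0]
      exact_mod_cast hk
    have hbreak : ∀ i < N, ∀ z ∈ I, ((z + i * a : ℝ) : UnitAddCircle) ∉ B := by
      intro i hi z hz hzB
      refine hpk (i, ((z + i * a : ℝ) : UnitAddCircle))
        (Finset.mk_mem_product (Finset.mem_range.2 hi) hzB) ?_
      have h1 : ((z + i * a : ℝ) : UnitAddCircle) - ((i * a : ℝ) : UnitAddCircle) = z := by
        rw [← AddCircle.coe_sub, add_sub_cancel_right]
      have h2 : z ∈ Ico (0 : ℝ) (0 + 1) := by rw [zero_add]; exact hI01 hz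
      have h3 : p (i, ((z + i * a : ℝ) : UnitAddCircle)) = z := by
        simp only [hp, h1]
        exact AddCircle.equivIco_coe_of_mem h2
      rwa [h3]
    have hlen : ((k + 1 : ℕ) : ℝ) / K = (k : ℝ) / K + 1 / K := by push_cast; ring
    refine volume_close_le (G := fun j x => ∑ i ∈ Finset.range j, f ((x + i * a : ℝ) : UnitAddCircle))
      (N := N) (v := ε) (ℓ := 1 / K) (t := t) hc ?_ ?_ ?_ hC0 le_rfl ?_ hJ0 ?_
    · intro j x
      rw [Finset.sum_range_succ]
      linarith [hf ((x + j * a : ℝ) : UnitAddCircle)]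
    · intro j hj x hx y hy hxy
      have h1 := abs_birkhoff_increment_le (F := fun x : ℝ => f x) (φ := φ) (q := q) (r := r)
        (S := S) (C := C) (a := a) hj hxy (fun z => by simp only [hrdef]; ring) hq hC hri
        (fun i hi => hfB.integral_deriv (by linarith) fun z hz => by
          have h2 := hbreak i hi (z - i * a)
            ⟨by linarith [hz.1, hx.1], by linarith [hz.2, hy.2]⟩
          rwa [sub_add_cancel] at h2)
      refine h1.trans (add_le_add le_rfl (le_trans ?_ hwk))
      exact intervalIntegral.integral_mono_interval hx.1 hxy hy.2.le
        (ae_of_all _ hw0) (hwi _ _)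
    · intro x hx y hy
      have := hy.2
      rw [hlen] at this
      linarith [hx.1]
    · have h1 : (N : ℝ) * |S| * (1 / K) = |S| / L := by rw [hKr]; field_simp
      have h2 : 2 * C * (1 / K) ≤ c / 4 := by
        rw [mul_one_div, div_le_iff₀ hKr0]
        have h3 : t / c ≤ K := by
          rw [hKr]
          nlinarith
        rw [div_le_iff₀ hc] at h3
        linarith
      rw [h1]
      linarith
    · rintro x ⟨⟨j, hj⟩, hxI⟩
      rw [abs_lt] at hj
      have hlow : (j : ℝ) * c ≤ ∑ i ∈ Finset.range j, f ((x + i * a : ℝ) : UnitAddCircle) := by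
        have := Finset.card_nsmul_le_sum (Finset.range j)
          (fun i : ℕ => f ((x + i * a : ℝ) : UnitAddCircle)) c fun i _ => hf _
        simpa using this
      have hup : ∑ i ∈ Finset.range j, f ((x + i * a : ℝ) : UnitAddCircle) ≤ j * M := by
        have := Finset.sum_le_card_nsmul (Finset.range j)
          (fun i : ℕ => f ((x + i * a : ℝ) : UnitAddCircle)) M fun i _ => hM _
        simpa using this
      -- From jc ≤ f^(j) < t + c comes j ≤ N; from jM ≥ f^(j) > t - ε ≥ t/2 comes j ≥ J.
      refine ⟨j, ?_, ?_, abs_lt.2 hj⟩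
      · have h1 : (j : ℝ) ≤ t / c + 1 := by
          rw [div_add_one hc.ne', le_div_iff₀ hc]
          linarith
        exact_mod_cast h1.trans hNlow
      · rw [hJdef, div_le_iff₀ (by positivity)]
        linarith
  -- The growth of K in t cancels against that of the slope. The three contributions are at most u/4
  -- each.
  · have h1 : (K : ℝ) * η ≤ u / 4 := by
      have h2 : η ≤ 3 * ε / (t * |S| / (4 * M)) := by
        rw [hη]
        gcongr
      calc (K : ℝ) * η ≤ (L * (2 * t / c)) * (3 * ε / (t * |S| / (4 * M))) := by
            rw [hKr]
            gcongr
        _ = 24 * L * M / (c * |S|) * ε := by field_simp; ring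
        _ ≤ 24 * L * M / (c * |S|) * (u * c * |S| / (96 * L * M)) := by gcongr
        _ = u / 4 := by field_simp; ring
    have h2 : ((Finset.range N ×ˢ B).card : ℝ) / K = B.card / L := by
      rw [Finset.card_product, Finset.card_range, hKr]
      push_cast
      field_simp
    have h3 : (∫ x in (0 : ℝ)..1, w x) / (K * ε) ≤ u / 4 := by
      rw [div_le_iff₀ (by positivity)]
      refine hwint.trans ?_
      rw [hKr]
      have : (N : ℝ) * (ε * u / 4) * 1 ≤ N * (ε * u / 4) * L := by gcongr
      linarith
    rw [h2]
    linarith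

end

/-! ### Returns of a special flow to a thin strip -/

/-- Measurability of f makes the inclusion of X^f a measurable embedding, which excludes the default
value 0 of `Measure.comap`. -/
theorem measure_eq_prod_image {X : Type*} [MeasurableSpace X] {μ : Measure X} {f : X → ℝ}
    (hf : Measurable f) (A : Set (Space f)) :
    measure μ f A = μ.prod volume (Subtype.val '' A) := by
  have hs : MeasurableSet {p : X × ℝ | 0 ≤ p.2 ∧ p.2 < f p.1} :=
    (measurableSet_le measurable_const measurable_snd).inter
      (measurableSet_lt measurable_snd (hf.comp measurable_fst))
  exact (MeasurableEmbedding.subtype_coe hs).comap_apply _ A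

/-- A negative index n would give f^(n+1)(x) ≤ f^(0)(x) = 0 ≤ r. Forward times therefore involve
only genuine Birkhoff sums. -/
theorem index_nonneg {X : Type*} (T : Equiv.Perm X) {f : X → ℝ} (hf : BoundedAwayFromZero f)
    (x : X) {r : ℝ} (hr : 0 ≤ r) : 0 ≤ index T hf x r := by
  obtain ⟨c, hc, hfc⟩ := hf
  by_contra hneg
  have h2 := (index_spec T ⟨c, hc, hfc⟩ x r).2
  set n := index T ⟨c, hc, hfc⟩ x r
  have h3 := cocycle_add_le T hfc x (n + 1) (-(n + 1)).toNat
  have h4 : n + 1 + ((-(n + 1)).toNat : ℤ) = 0 := by omega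
  rw [h4, cocycle_zero] at h3
  have : 0 ≤ ((-(n + 1)).toNat : ℝ) * c := by positivity
  linarith

/-- If a special flow returns to the strip `{s < ε}` at time `t ≥ 0`, then some Birkhoff sum of the
roof is `ε`-close to `t`. -/
theorem exists_abs_cocycle_sub_lt {X : Type*} (T : Equiv.Perm X) {f : X → ℝ}
    (hf : BoundedAwayFromZero f) {t ε : ℝ} (ht : 0 ≤ t) {p : Space f} (hp : p.1.2 < ε)
    (hq : (flow T hf t p).1.2 < ε) : ∃ j : ℕ, |cocycle T f j p.1.1 - t| < ε := by
  have hn := index_nonneg T hf p.1.1 (add_nonneg p.2.1 ht)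
  refine ⟨(index T hf p.1.1 (p.1.2 + t)).toNat, ?_⟩
  rw [Int.toNat_of_nonneg hn, abs_lt]
  -- f^(j)(x) - t is the difference of the initial and final heights, both in [0, ε).
  have h1 : p.1.2 + t - cocycle T f (index T hf p.1.1 (p.1.2 + t)) p.1.1 < ε := hq
  have h2 := (index_spec T hf p.1.1 (p.1.2 + t)).1
  have h3 := p.2.1
  constructor <;> linarith

/-- If a special flow is partially rigid along `t`, then the Birkhoff sums of the roof come close to
`t n` on a set whose measure is bounded below. -/
theorem PartiallyRigidAlong.exists_le_liminf {X : Type*} [MeasurableSpace X] {μ : Measure X}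
    [IsProbabilityMeasure μ] (T : Equiv.Perm X) {f : X → ℝ} (hfm : Measurable f)
    (hf : BoundedAwayFromZero f) {t : ℕ → ℝ} (ht : Tendsto t atTop atTop)
    (h : PartiallyRigidAlong (flow T hf) (measure μ f) t) :
    ∃ u : ℝ, 0 < u ∧ ∀ c ε : ℝ, (∀ x, c ≤ f x) → 0 < ε → ε < c →
      ∀ v : ℝ, v < u → ∀ᶠ n in atTop,
        ENNReal.ofReal v < μ {x | ∃ j : ℕ, |cocycle T f j x - t n| < ε} := by
  obtain ⟨u, hu, -, H⟩ := h
  refine ⟨u, hu, fun c ε hc hε hεc v hv => ?_⟩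
  set A : Set (Space f) := {p | p.1.2 < ε} with hA
  have hAm : MeasurableSet A :=
    measurableSet_lt (measurable_snd.comp measurable_subtype_coe) measurable_const
  have hA' : Subtype.val '' A = (univ : Set X) ×ˢ Ico 0 ε := by
    ext ⟨x, s⟩
    constructor
    · rintro ⟨p, hp, hpe⟩
      rw [← hpe]
      exact ⟨trivial, p.2.1, hp⟩
    · rintro ⟨-, h1, h2⟩
      exact ⟨⟨(x, s), h1, h2.trans (hεc.trans_le (hc x))⟩, h2, rfl⟩
  have hμA : measure μ f A = ENNReal.ofReal ε := by
    rw [measure_eq_prod_image hfm, hA', Measure.prod_prod, Real.volume_Ico]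
    simp
  have hlim := H A hAm
  rw [hμA] at hlim
  have hlt : ENNReal.ofReal v * ENNReal.ofReal ε <
      liminf (fun n => measure μ f (A ∩ flow T hf (t n) ⁻¹' A)) atTop := by
    refine lt_of_lt_of_le ?_ hlim
    exact (ENNReal.mul_lt_mul_iff_left (ENNReal.ofReal_pos.2 hε).ne' ENNReal.ofReal_ne_top).2
      ((ENNReal.ofReal_lt_ofReal_iff hu).2 hv)
  filter_upwards [eventually_lt_of_lt_liminf hlt, ht.eventually_ge_atTop 0] with n hn htn
  -- The returning set lies in a product of height ε, the height of the strip itself, so ε cancels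
  -- and the bound on the base is independent of it.
  have hsub : Subtype.val '' (A ∩ flow T hf (t n) ⁻¹' A) ⊆
      {x | ∃ j : ℕ, |cocycle T f j x - t n| < ε} ×ˢ Ico 0 ε := by
    rintro _ ⟨p, ⟨hp1, hp2⟩, rfl⟩
    exact ⟨exists_abs_cocycle_sub_lt T hf htn hp1 hp2, p.2.1, hp1⟩
  rw [measure_eq_prod_image hfm] at hn
  have h1 := hn.trans_le (measure_mono hsub)
  rw [Measure.prod_prod, Real.volume_Ico, sub_zero] at h1
  exact lt_of_mul_lt_mul_right h1 zero_le

/-! ### The rotation cocycle and the conclusion -/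

theorem rotation_zpow_apply (α x : UnitAddCircle) (n : ℕ) :
    (rotation α ^ (n : ℤ)) x = x + n • α := by
  rw [zpow_natCast]
  induction n with
  | zero => simp
  | succ n ih =>
    rw [pow_succ', Equiv.Perm.mul_apply, ih, succ_nsmul, ← add_assoc]
    rfl

theorem cocycle_rotation (α x : UnitAddCircle) (f : UnitAddCircle → ℝ) (n : ℕ) :
    cocycle (rotation α) f n x = ∑ i ∈ Finset.range n, f (x + i • α) := by
  change ∑ i ∈ Finset.range n, f ((rotation α ^ (i : ℤ)) x) = _
  simp only [rotation_zpow_apply]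

theorem volume_eq_volume_preimage_inter_Ico {U : Set UnitAddCircle} (hU : MeasurableSet U) :
    volume U = volume ((fun x : ℝ => (x : UnitAddCircle)) ⁻¹' U ∩ Ico 0 1) := by
  rw [AddCircle.add_projection_respects_measure 1 0 hU, zero_add]
  exact measure_congr ((ae_eq_refl _).inter Ico_ae_eq_Ioc.symm)

end SpecialFlow

theorem mainTheorem4 (α : UnitAddCircle)
    (hα : Ergodic (SpecialFlow.rotation α) (volume : Measure UnitAddCircle))
    (f : UnitAddCircle → ℝ) (hf : SpecialFlow.BoundedAwayFromZero f)
    (B : Finset UnitAddCircle) (hfB : SpecialFlow.PiecewiseAbsCont f B)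
    (hS : SpecialFlow.sumOfJumps f B ≠ 0)
    (t : ℕ → ℝ) (ht : Tendsto t atTop atTop) :
    ¬ SpecialFlow.PartiallyRigidAlong (SpecialFlow.flow (SpecialFlow.rotation α) hf)
        (SpecialFlow.measure volume f) t := by
  intro hrigid
  have : IsProbabilityMeasure (volume : Measure UnitAddCircle) := ⟨UnitAddCircle.measure_univ⟩
  obtain ⟨c, hc, hfc⟩ := id hf
  have hα0 : addOrderOf α = 0 := AddCircle.ergodic_add_right.1 hα
  obtain ⟨a, rfl⟩ := QuotientAddGroup.mk_surjective α
  obtain ⟨u, hu, H⟩ := hrigid.exists_le_liminf _ hfB.measurable hf ht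
  -- Since u does not depend on ε, the strip may be chosen after u; u/2 provides the strict
  -- inequality needed on the rigidity side.
  obtain ⟨ε, hε, hεc, hev⟩ := SpecialFlow.exists_eventually_volume_close_le hα0 hc hfc hfB hS
    (half_pos hu)
  obtain ⟨n, h1, h2⟩ := ((H c ε hfc hε hεc (u / 2) (half_lt_self hu)).and (ht.eventually hev)).exists
  refine absurd h2 (not_le.2 (h1.trans_le (le_of_eq ?_)))
  have hmeas : ∀ j : ℕ, Measurable (SpecialFlow.cocycle (SpecialFlow.rotation a) f j) := fun j => by
    have : SpecialFlow.cocycle (SpecialFlow.rotation (a : UnitAddCircle)) f j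
        = fun x => ∑ i ∈ Finset.range j, f (x + i • (a : UnitAddCircle)) :=
      funext fun x => SpecialFlow.cocycle_rotation _ x f j
    rw [this]
    exact Finset.measurable_sum _ fun i _ => hfB.measurable.comp (measurable_add_const _)
  have hU : MeasurableSet
      {x | ∃ j : ℕ, |SpecialFlow.cocycle (SpecialFlow.rotation a) f j x - t n| < ε} := by
    simp only [ofPred_exists]
    exact MeasurableSet.iUnion fun j =>
      measurableSet_lt (((hmeas j).sub_const _).abs) measurable_const
  rw [SpecialFlow.volume_eq_volume_preimage_inter_Ico hU]
  congr 2
  ext x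
  have h3 : ∀ i : ℕ, ((x + i * a : ℝ) : UnitAddCircle) = x + i • (a : UnitAddCircle) := fun i => by
    rw [AddCircle.coe_add, ← AddCircle.coe_nsmul, nsmul_eq_mul]
  simp only [mem_preimage, mem_ofPred_eq, SpecialFlow.cocycle_rotation, h3]
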